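/- **Theorem 4.4.** Let $\mathbb{D}$ be the open unit disk and $A(\mathbb{D})$ the disk algebra. Let $\mathcal{H}$ be a Hilbert module over $A(\mathbb{D})$, that is, a complex Hilbert space with a unital algebra homomorphism $A(\mathbb{D})\to\mathcal{B}(\mathcal{H})$ that is continuous for the supremum norm and the operator norm, and let $M_z\in\mathcal{B}(\mathcal{H})$ be the image of the coordinate function. Assume that $\mathcal{H}\in B_1^*(\mathbb{D})$: for every $w\in\mathbb{D}$ the operator $(M_z-w)^*$ has closed range and $\dim\ker(M_z-w)^*=1$, and the subspaces $\ker(M_z-w)^*$, $w\in\mathbb{D}$, span a dense subspace of $\mathcal{H}$. Let $p,q\ge 0$ be integers and let $\Theta\in H^\infty_{\mathcal{B}(\mathbb{C}^p,\mathbb{C}^q)}(\mathbb{D})$ (bounded and holomorphic on $\mathbb{D}$) have a left inverse in $H^\infty_{\mathcal{B}(\mathbb{C}^q,\mathbb{C}^p)}(\mathbb{D})$, that is, there is $\Psi\in H^\infty_{\mathcal{B}(\mathbb{C}^q,\mathbb{C}^p)}(\mathbb{D})$ with $\Psi(z)\Theta(z)=I$ for all $z\in\mathbb{D}$. For a finite-dimensional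 Hilbert space $\mathcal{E}$, $w\in\mathbb{D}$ and $k\in\ker(M_z-w)^*$, let $\mathrm{ev}_k:\mathcal{H}\otimes\mathcal{E}\to\mathcal{E}$ be the linear map with $\mathrm{ev}_k(h\otimes x)=\langle h,k\rangle x$ (inner product linear in the first variable). Multiplication by $\Theta$ is defined by: $g=\Theta h$, for $h\in\mathcal{H}\otimes\mathbb{C}^p$ and $g\in\mathcal{H}\otimes\mathbb{C}^q$, if $\mathrm{ev}_k(g)=\Theta(w)\,\mathrm{ev}_k(h)$ for all $w\in\mathbb{D}$ and $k\in\ker(M_z-w)^*$. Then $\Theta$ is a multiplier for $\mathcal{H}$ and for the Hardy module $H^2(\mathbb{D})$ with multiplication by $z$: there are bounded operators $M_\Theta$ from $\mathcal{H}\otimes\mathbb{C}^p$ to $\mathcal{H}\otimes\mathbb{C}^q$ and from $H^2(\mathbb{D})\otimes\mathbb{C}^p$ to $H^2(\mathbb{D})\otimes\mathbb{C}^q$ with $M_\Theta h=\Theta h$ for all $h$. Consider the quotient modules $$\mathcal{H}_\Theta=(\mathcal{H}\otimes\mathbb{C}^q)/M_\Theta(\mathcal{H}\otimes\mathbb{C}^p),\qquad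 H^2_\Theta=(H^2(\mathbb{D})\otimes\mathbb{C}^q)/M_\Theta(H^2(\mathbb{D})\otimes\mathbb{C}^p),$$ with the module multiplication by $z$ induced by $M_z\otimes I$. For every finite-dimensional complex Hilbert space $\mathcal{F}$, the module $\mathcal{H}_\Theta$ is similar to $\mathcal{H}\otimes\mathcal{F}$ if and only if $H^2_\Theta$ is similar to $H^2(\mathbb{D})\otimes\mathcal{F}$. Here two modules are similar if there is a bounded linear bijection with bounded inverse between them that intertwines the multiplications by $z$. -/

import Mathlib

open scoped TensorProduct ENNReal InnerProductSpace

noncomputable section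

/-- The disk algebra `A(𝔻)`: continuous functions on the closed unit disk that are holomorphic in
the open unit disk, as a subalgebra of `C(closedBall 0 1, ℂ)` with the supremum norm. -/
def DiskAlgebra : Subalgebra ℂ C(Metric.closedBall (0 : ℂ) 1, ℂ) where
  carrier := {f | ∃ g : ℂ → ℂ, DifferentiableOn ℂ g (Metric.ball 0 1) ∧
    ∀ z : Metric.closedBall (0 : ℂ) 1, (z : ℂ) ∈ Metric.ball (0 : ℂ) 1 → f z = g z}
  mul_mem' := by
    rintro f₁ f₂ ⟨g₁, h₁, e₁⟩ ⟨g₂, h₂, e₂⟩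
    exact ⟨g₁ * g₂, h₁.mul h₂, fun z hz => by simp [e₁ z hz, e₂ z hz]⟩
  add_mem' := by
    rintro f₁ f₂ ⟨g₁, h₁, e₁⟩ ⟨g₂, h₂, e₂⟩
    exact ⟨g₁ + g₂, h₁.add h₂, fun z hz => by simp [e₁ z hz, e₂ z hz]⟩
  algebraMap_mem' c := ⟨fun _ => c, differentiableOn_const c, fun z _ => by simp⟩

/-- The coordinate function `z`, as an element of the disk algebra. -/
def DiskAlgebra.coord : DiskAlgebra :=
  ⟨⟨fun z => (z : ℂ), continuous_subtype_val⟩, fun z => z, differentiableOn_id, fun _ _ => rfl⟩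

section HilbertModules

/-! A Hilbert module over `ℂ[z]` is a Hilbert space `H` with a bounded operator `T`, the module
multiplication by the coordinate function. -/

variable {H : Type*} [NormedAddCommGroup H] [InnerProductSpace ℂ H]

/-- The fibre `ker (T - w)*` at `w` of the eigenvector bundle of the Hilbert module `(H, T)`. -/
def eigenFibre [CompleteSpace H] (T : H →L[ℂ] H) (w : ℂ) : Submodule ℂ H :=
  LinearMap.ker (ContinuousLinearMap.adjoint (T - w • ContinuousLinearMap.id ℂ H) : H →ₗ[ℂ] H)

/-- `(H, T)` belongs to the class `B_m^*(Ω)`, for a positive integer `m` and `Ω ⊆ ℂ`. -/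
structure IsCowenDouglasDual [CompleteSpace H] (m : ℕ) (Ω : Set ℂ) (T : H →L[ℂ] H) : Prop where
  isClosed_range : ∀ w ∈ Ω, IsClosed
    (Set.range (ContinuousLinearMap.adjoint (T - w • ContinuousLinearMap.id ℂ H)))
  finrank_fibre : ∀ w ∈ Ω, Module.finrank ℂ (eigenFibre T w) = m
  span_fibres : (⨆ w ∈ Ω, eigenFibre T w).topologicalClosure = ⊤

/-- Two Hilbert modules (the underlying spaces being given with their topologies) are similar if
there is an invertible module map, bounded with bounded inverse, between them. -/
def AreSimilar {V W : Type*} [TopologicalSpace V] [AddCommGroup V] [Module ℂ V]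
    [TopologicalSpace W] [AddCommGroup W] [Module ℂ W] (A : V →L[ℂ] V) (B : W →L[ℂ] W) : Prop :=
  ∃ X : V ≃L[ℂ] W, ∀ v, X (A v) = B (X v)

/-- `Θ ∈ H^∞(𝔻)` with values in a normed space `E`: holomorphic and bounded on the unit disk. -/
structure IsHInfty {E : Type*} [NormedAddCommGroup E] [NormedSpace ℂ E] (Θ : ℂ → E) : Prop where
  differentiableOn : DifferentiableOn ℂ Θ (Metric.ball 0 1)
  bounded : ∃ C : ℝ, ∀ z ∈ Metric.ball (0 : ℂ) 1, ‖Θ z‖ ≤ C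

/-- For `k ∈ H`, the map `H ⊗ E → E`, `h ⊗ x ↦ ⟪k, h⟫ x`. For `k ∈ ker (T - w)*` this is the
value at `w`, relative to the vector `k` of the fibre, of the function represented by an element
of `H ⊗ E`. -/
def evalAt (E : Type*) [NormedAddCommGroup E] [InnerProductSpace ℂ E] (k : H) :
    H ⊗[ℂ] E →L[ℂ] E :=
  ((TensorProduct.lidIsometry ℂ E).toContinuousLinearEquiv : ℂ ⊗[ℂ] E →L[ℂ] E) ∘L
    (innerSL ℂ k).rTensor E

theorem evalAt_tmul {E : Type*} [NormedAddCommGroup E] [InnerProductSpace ℂ E] (k h : H) (x : E) :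
    evalAt E k (h ⊗ₜ[ℂ] x) = ⟪k, h⟫_ℂ • x := by
  simp [evalAt]

variable [CompleteSpace H]

variable {E G : Type*} [NormedAddCommGroup E] [InnerProductSpace ℂ E]
  [NormedAddCommGroup G] [InnerProductSpace ℂ G]

theorem evalAt_rTensor {T : H →L[ℂ] H} {w : ℂ} {k : H} (hk : k ∈ eigenFibre T w)
    (g : H ⊗[ℂ] E) : evalAt E k (T.rTensor E g) = w • evalAt E k g := by
  have key : ∀ h : H, ⟪k, T h⟫_ℂ = w * ⟪k, h⟫_ℂ := by
    intro h
    have h1 : ContinuousLinearMap.adjoint (T - w • ContinuousLinearMap.id ℂ H) k = 0 := hk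
    have h2 := ContinuousLinearMap.adjoint_inner_left (T - w • ContinuousLinearMap.id ℂ H) h k
    rw [h1, inner_zero_left] at h2
    simp only [sub_apply, smul_apply, ContinuousLinearMap.id_apply,
      inner_sub_right, inner_smul_right] at h2
    linear_combination -h2
  induction g using TensorProduct.induction_on with
  | zero => simp
  | tmul h x =>
    rw [ContinuousLinearMap.rTensor_tmul, evalAt_tmul, evalAt_tmul, key, mul_smul]
  | add a b ha hb => rw [map_add, map_add, map_add, smul_add, ha, hb]

/-- `g = Θ h` pointwise on the unit disk, for `h ∈ H ⊗ E` and `g ∈ H ⊗ G`. -/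
def IsPointwiseProduct (T : H →L[ℂ] H) (Θ : ℂ → E →L[ℂ] G) (h : H ⊗[ℂ] E) (g : H ⊗[ℂ] G) :
    Prop :=
  ∀ w ∈ Metric.ball (0 : ℂ) 1, ∀ k ∈ eigenFibre T w, evalAt G k g = Θ w (evalAt E k h)

/-- `Θ` is a multiplier from `H ⊗ E` to `H ⊗ G`: pointwise multiplication by `Θ` is a bounded
operator. -/
def IsMultiplier (T : H →L[ℂ] H) (Θ : ℂ → E →L[ℂ] G) : Prop :=
  ∃ M : H ⊗[ℂ] E →L[ℂ] H ⊗[ℂ] G, ∀ h, IsPointwiseProduct T Θ h (M h)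

/-- The range `M_Θ (H ⊗ E) ⊆ H ⊗ G` of multiplication by `Θ`. -/
def mulRange (T : H →L[ℂ] H) (Θ : ℂ → E →L[ℂ] G) : Submodule ℂ (H ⊗[ℂ] G) where
  carrier := {g | ∃ h : H ⊗[ℂ] E, IsPointwiseProduct T Θ h g}
  add_mem' := by
    rintro a b ⟨x, hx⟩ ⟨y, hy⟩
    exact ⟨x + y, fun w hw k hk => by simp [hx w hw k hk, hy w hw k hk]⟩
  zero_mem' := ⟨0, fun w hw k hk => by simp⟩
  smul_mem' := by
    rintro c a ⟨x, hx⟩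
    exact ⟨c • x, fun w hw k hk => by simp [hx w hw k hk]⟩

theorem mulRange_le_comap (T : H →L[ℂ] H) (Θ : ℂ → E →L[ℂ] G) :
    mulRange T Θ ≤ (mulRange T Θ).comap (T.rTensor G : H ⊗[ℂ] G →ₗ[ℂ] H ⊗[ℂ] G) := by
  rintro g ⟨h, hh⟩
  refine ⟨T.rTensor E h, fun w hw k hk => ?_⟩
  have h1 := evalAt_rTensor hk g
  have h2 := evalAt_rTensor hk h
  rw [h2, map_smul, ← hh w hw k hk]
  exact h1

/-- The module multiplication by the coordinate function on the quotient module
`H_Θ = (H ⊗ G) / M_Θ (H ⊗ E)`. -/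
def quotientShift (T : H →L[ℂ] H) (Θ : ℂ → E →L[ℂ] G) :
    ((H ⊗[ℂ] G) ⧸ mulRange T Θ) →L[ℂ] ((H ⊗[ℂ] G) ⧸ mulRange T Θ) :=
  (mulRange T Θ).liftQL ((mulRange T Θ).mkQL ∘L T.rTensor G) fun _ hg =>
    (Submodule.Quotient.mk_eq_zero _).2 (mulRange_le_comap T Θ hg)

end HilbertModules

/-- The Hardy space `H²(𝔻)`: power series `∑ aₙ zⁿ` on the unit disk with square-summable
coefficients, and the norm `(∑ |aₙ|²)^{1/2}`; an element is stored by its coefficients, and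
becomes a function on the disk through the instance of `RKHS` below. -/
def HardySpace : Type := lp (fun _ : ℕ => ℂ) 2

namespace HardySpace

instance : NormedAddCommGroup HardySpace := inferInstanceAs (NormedAddCommGroup (lp _ 2))
instance : InnerProductSpace ℂ HardySpace :=
  inferInstanceAs (InnerProductSpace ℂ (lp (fun _ : ℕ => ℂ) 2))
instance : CompleteSpace HardySpace := inferInstanceAs (CompleteSpace (lp (fun _ : ℕ => ℂ) 2))

/-- The `n`-th Taylor coefficient. -/
def coeff (f : HardySpace) (n : ℕ) : ℂ := (show lp (fun _ : ℕ => ℂ) 2 from f) n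

theorem summable_sq (f : HardySpace) : Summable fun n => ‖f.coeff n‖ ^ 2 := by
  have h := (lp.memℓp (show lp (fun _ : ℕ => ℂ) 2 from f)).summable (by norm_num)
  simp only [ENNReal.toReal_ofNat, Real.rpow_ofNat] at h
  exact h

theorem norm_sq_eq (f : HardySpace) : ‖f‖ ^ 2 = ∑' n, ‖f.coeff n‖ ^ 2 := by
  have h := lp.norm_rpow_eq_tsum (p := 2) (by norm_num) (show lp (fun _ : ℕ => ℂ) 2 from f)
  simp only [ENNReal.toReal_ofNat, Real.rpow_ofNat] at h
  exact h

/-- The element of the Hardy space with given square-summable coefficients. -/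
def ofCoeff (a : ℕ → ℂ) (ha : Summable fun n => ‖a n‖ ^ 2) : HardySpace :=
  show lp (fun _ : ℕ => ℂ) 2 from ⟨a, memℓp_gen (by simpa using ha)⟩

theorem ext_coeff {f g : HardySpace} (h : ∀ n, f.coeff n = g.coeff n) : f = g :=
  lp.ext (funext h)

/-- The Szegő kernel function `z ↦ 1 / (1 - z * conj w)`. -/
def szego (w : Metric.ball (0 : ℂ) 1) : HardySpace :=
  ofCoeff (fun n => (starRingEnd ℂ (w : ℂ)) ^ n) <| by
    have hw : ‖(w : ℂ)‖ < 1 := mem_ball_zero_iff.1 w.2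
    have : Summable fun n : ℕ => (‖(w : ℂ)‖ ^ 2) ^ n :=
      summable_geometric_of_lt_one (by positivity) (by nlinarith [norm_nonneg (w : ℂ)])
    refine this.congr fun n => ?_
    simp [pow_right_comm]

theorem hasSum_inner_szego (w : Metric.ball (0 : ℂ) 1) (f : HardySpace) :
    HasSum (fun n => f.coeff n * (w : ℂ) ^ n) ⟪szego w, f⟫_ℂ := by
  have h := lp.hasSum_inner (𝕜 := ℂ) (show lp (fun _ : ℕ => ℂ) 2 from szego w)
    (show lp (fun _ : ℕ => ℂ) 2 from f)
  have e : (fun n => f.coeff n * (w : ℂ) ^ n) =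
      fun n => f.coeff n * (starRingEnd ℂ) ((starRingEnd ℂ (w : ℂ)) ^ n) := by
    funext n
    simp
  rw [e]
  exact h

/-- The value at a point `w` of the unit disk of the power series with coefficients `f.coeff`. -/
def eval (f : HardySpace) (w : Metric.ball (0 : ℂ) 1) : ℂ := ∑' n, f.coeff n * (w : ℂ) ^ n

theorem eval_eq_inner (f : HardySpace) (w : Metric.ball (0 : ℂ) 1) :
    f.eval w = ⟪szego w, f⟫_ℂ := (hasSum_inner_szego w f).tsum_eq

theorem eval_injective : Function.Injective eval := by
  intro f g hfg
  have key : ∀ f : HardySpace, HasFPowerSeriesAt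
      (fun z : ℂ => ∑' n, f.coeff n * z ^ n)
      (FormalMultilinearSeries.ofScalars ℂ f.coeff) 0 := by
    intro f
    refine hasFPowerSeriesAt_iff.2 ?_
    filter_upwards [Metric.ball_mem_nhds (0 : ℂ) one_pos] with z hz
    have := (hasSum_inner_szego ⟨z, hz⟩ f).summable.hasSum
    simpa [mul_comm] using this
  have h2 : (fun z : ℂ => ∑' n, f.coeff n * z ^ n) =ᶠ[nhds 0]
      fun z : ℂ => ∑' n, g.coeff n * z ^ n := by
    filter_upwards [Metric.ball_mem_nhds (0 : ℂ) one_pos] with z hz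
    exact congrFun hfg ⟨z, hz⟩
  have h3 := (key f).eq_formalMultilinearSeries_of_eventually (key g) h2
  refine ext_coeff fun n => ?_
  have := congrArg (fun p : FormalMultilinearSeries ℂ ℂ ℂ => p.coeff n) h3
  simpa using this

/-- The Hardy space as a reproducing kernel Hilbert space of functions on the unit disk. -/
instance : RKHS ℂ HardySpace (Metric.ball (0 : ℂ) 1) ℂ where
  coeCLM :=
    { toFun := eval
      map_add' := fun f g => by ext w; simp [eval_eq_inner]
      map_smul' := fun c f => by ext w; simp [eval_eq_inner]
      cont := by
        refine continuous_pi fun w => ?_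
        simp only [eval_eq_inner]
        fun_prop }
  coeCLM_injective := eval_injective

theorem apply_eq_tsum (f : HardySpace) (w : Metric.ball (0 : ℂ) 1) :
    f w = ∑' n, f.coeff n * (w : ℂ) ^ n := rfl

/-- The coefficients `0, a₀, a₁, …` of `z ↦ z * f z`. -/
def shiftCoeff (a : ℕ → ℂ) : ℕ → ℂ
  | 0 => 0
  | n + 1 => a n

theorem summable_shiftCoeff {a : ℕ → ℂ} (ha : Summable fun n => ‖a n‖ ^ 2) :
    Summable fun n => ‖shiftCoeff a n‖ ^ 2 :=
  (summable_nat_add_iff 1).1 ha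

/-- Multiplication by the coordinate function `z` on the Hardy space. -/
def mulZ : HardySpace →L[ℂ] HardySpace :=
  LinearMap.mkContinuous
    { toFun := fun f => ofCoeff (shiftCoeff f.coeff) (summable_shiftCoeff f.summable_sq)
      map_add' := fun f g => ext_coeff fun n => by
        cases n
        · exact (add_zero (0 : ℂ)).symm
        · rfl
      map_smul' := fun c f => ext_coeff fun n => by
        cases n
        · exact (mul_zero c).symm
        · rfl } 1 fun f => by
    rw [one_mul]
    refine (sq_le_sq₀ (norm_nonneg _) (norm_nonneg _)).1 (le_of_eq ?_)
    rw [norm_sq_eq, norm_sq_eq]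
    exact ((summable_shiftCoeff f.summable_sq).tsum_eq_zero_add).trans (by simp [shiftCoeff])

theorem mulZ_apply (f : HardySpace) (w : Metric.ball (0 : ℂ) 1) :
    mulZ f w = (w : ℂ) * f w := by
  rw [apply_eq_tsum, (hasSum_inner_szego w (mulZ f)).summable.tsum_eq_zero_add, apply_eq_tsum,
    ← tsum_mul_left]
  have h0 : (mulZ f).coeff 0 = 0 := rfl
  rw [h0, zero_mul, zero_add]
  refine tsum_congr fun n => ?_
  have h1 : (mulZ f).coeff (n + 1) = f.coeff n := rfl
  rw [h1, pow_succ]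
  ring

end HardySpace

end

/-! Both similarities are equivalent to one condition that does not mention the module: there are
bounded holomorphic Φ and Ω on the disk with ΦΘ = 0, ΦΩ = I and ΩΦ = I - ΘΨ
(`areSimilar_quotientShift_iff`). Since ΨΘ = I, the operator I - M_Θ M_Ψ is a projection whose
kernel is the range of M_Θ, so the quotient module is a copy of its range. A similarity X then
yields module maps H ⊗ G → H ⊗ F and back, and their symbols are Φ and Ω. Conversely, multiplication
by Φ descends to the quotient, and multiplication by Ω followed by the quotient map inverts it.

This dictionary needs two facts about the module: bounded holomorphic functions multiply boundedly,
and every module map between its finite multiples has a bounded holomorphic symbol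
(`exists_symbol`). `IsMultiplierModule` collects what suffices for both, and is verified twice.

For H, multipliers are obtained from the disk algebra action by dilating f to f(rz) and letting r
tend to 1. Local sections come from a left inverse of T - w, whose existence rests on closed range
and on T having no eigenvalue in the disk. For the Hardy module the fibres are spanned by Szegő
kernels, and multipliers are bounded by Parseval on circles of radius r < 1. -/

noncomputable section

/-! ### Evaluations and components on Hilbert space tensor products -/

section MultiplierModules

variable {H : Type*} [NormedAddCommGroup H] [InnerProductSpace ℂ H]
variable {E G F : Type*} [NormedAddCommGroup E] [InnerProductSpace ℂ E]
  [NormedAddCommGroup G] [InnerProductSpace ℂ G] [NormedAddCommGroup F] [InnerProductSpace ℂ F]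

theorem norm_evalAt_le (k : H) (u : H ⊗[ℂ] E) : ‖evalAt E k u‖ ≤ ‖k‖ * ‖u‖ := by
  have h : ‖evalAt E k u‖ = ‖(innerSL ℂ k).rTensor E u‖ :=
    (TensorProduct.lidIsometry ℂ E).norm_map _
  rw [h]
  refine (((innerSL ℂ k).rTensor E).le_opNorm u).trans ?_
  gcongr
  exact (ContinuousLinearMap.norm_rTensor_le E _).trans (innerSL_apply_norm ℂ k).le

theorem evalAt_smul_left (c : ℂ) (k : H) (u : H ⊗[ℂ] E) :
    evalAt E (c • k) u = starRingEnd ℂ c • evalAt E k u := by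
  induction u using TensorProduct.induction_on with
  | zero => simp
  | tmul h x => rw [evalAt_tmul, evalAt_tmul, inner_smul_left, mul_smul]
  | add a b ha hb => rw [map_add, map_add, ha, hb, smul_add]

/-- The component of an element of `H ⊗ E` along a vector `x` of `E`. -/
def componentAlong (H : Type*) [NormedAddCommGroup H] [InnerProductSpace ℂ H] (x : E) :
    H ⊗[ℂ] E →L[ℂ] H :=
  ((TensorProduct.ridIsometry ℂ H).toContinuousLinearEquiv : H ⊗[ℂ] ℂ →L[ℂ] H) ∘L
    (innerSL ℂ x).lTensor H

theorem componentAlong_tmul (x : E) (h : H) (y : E) :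
    componentAlong H x (h ⊗ₜ[ℂ] y) = ⟪x, y⟫_ℂ • h := by
  simp [componentAlong]

theorem sum_componentAlong_tmul {ι : Type*} [Fintype ι] (b : OrthonormalBasis ι ℂ E)
    (u : H ⊗[ℂ] E) : ∑ i, componentAlong H (b i) u ⊗ₜ[ℂ] b i = u := by
  induction u using TensorProduct.induction_on with
  | zero => simp
  | tmul h x =>
    simp only [componentAlong_tmul, TensorProduct.smul_tmul, ← TensorProduct.tmul_sum]
    rw [b.sum_repr' x]
  | add a c ha hc =>
    simp only [map_add, TensorProduct.add_tmul, Finset.sum_add_distrib]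
    rw [ha, hc]

theorem inner_componentAlong (k : H) (x : E) (u : H ⊗[ℂ] E) :
    ⟪k, componentAlong H x u⟫_ℂ = ⟪x, evalAt E k u⟫_ℂ := by
  induction u using TensorProduct.induction_on with
  | zero => simp
  | tmul h y =>
    rw [evalAt_tmul, componentAlong_tmul, inner_smul_right, inner_smul_right, mul_comm]
  | add a c ha hc => rw [map_add, map_add, inner_add_right, inner_add_right, ha, hc]

variable [CompleteSpace H]

theorem mem_eigenFibre_iff {T : H →L[ℂ] H} {w : ℂ} {k : H} :
    k ∈ eigenFibre T w ↔ ∀ h, ⟪k, T h⟫_ℂ = w * ⟪k, h⟫_ℂ := by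
  have key : ∀ h, ⟪ContinuousLinearMap.adjoint (T - w • ContinuousLinearMap.id ℂ H) k, h⟫_ℂ
      = ⟪k, T h⟫_ℂ - w * ⟪k, h⟫_ℂ := fun h => by
    rw [ContinuousLinearMap.adjoint_inner_left]
    simp [inner_sub_right, inner_smul_right]
  constructor
  · intro hk h
    have h1 : ContinuousLinearMap.adjoint (T - w • ContinuousLinearMap.id ℂ H) k = 0 := hk
    have h2 := key h
    rw [h1, inner_zero_left] at h2
    linear_combination -h2
  · intro hk
    refine LinearMap.mem_ker.2 (ext_inner_right ℂ fun h => ?_)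
    rw [inner_zero_left]
    refine (key h).trans ?_
    rw [hk h, sub_self]

/-- A Hilbert module with one-dimensional fibres over the unit disk, spanning a dense subspace and
admitting holomorphic local sections, on which every bounded holomorphic function is a
multiplier. -/
structure IsMultiplierModule (T : H →L[ℂ] H) : Prop where
  finrank_fibre : ∀ w ∈ Metric.ball (0 : ℂ) 1, Module.finrank ℂ (eigenFibre T w) = 1
  ext_fibres : ∀ h : H, (∀ w ∈ Metric.ball (0 : ℂ) 1, ∀ k ∈ eigenFibre T w, ⟪k, h⟫_ℂ = 0) → h = 0
  exists_section : ∀ w₀ ∈ Metric.ball (0 : ℂ) 1, ∃ k : ℂ → H, k w₀ ≠ 0 ∧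
    (∀ᶠ w in nhds w₀, k w ∈ eigenFibre T w) ∧
    ∀ h, DifferentiableAt ℂ (fun w => ⟪k w, h⟫_ℂ) w₀
  exists_multiplier : ∀ f : ℂ → ℂ, IsHInfty f → ∃ A : H →L[ℂ] H,
    ∀ w ∈ Metric.ball (0 : ℂ) 1, ∀ k ∈ eigenFibre T w, ∀ h, ⟪k, A h⟫_ℂ = f w * ⟪k, h⟫_ℂ

/-! ### Multiplication operators, symbols and quotient modules -/

namespace IsMultiplierModule

variable {T : H →L[ℂ] H}

theorem exists_ne_zero (hT : IsMultiplierModule T) {w : ℂ} (hw : w ∈ Metric.ball (0 : ℂ) 1) :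
    ∃ k ∈ eigenFibre T w, k ≠ 0 := by
  obtain ⟨k, hk, -⟩ := finrank_eq_one_iff'.1 (hT.finrank_fibre w hw)
  exact ⟨k, k.2, fun h => hk (Subtype.ext h)⟩

theorem exists_eq_smul (hT : IsMultiplierModule T) {w : ℂ} (hw : w ∈ Metric.ball (0 : ℂ) 1)
    {k k' : H} (hk : k ∈ eigenFibre T w) (hk0 : k ≠ 0) (hk' : k' ∈ eigenFibre T w) :
    ∃ c : ℂ, k' = c • k := by
  obtain ⟨c, hc⟩ := exists_smul_eq_of_finrank_eq_one (hT.finrank_fibre w hw)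
    (x := ⟨k, hk⟩) (fun h => hk0 (congrArg Subtype.val h)) ⟨k', hk'⟩
  exact ⟨c, (congrArg Subtype.val hc).symm⟩

/-- Evaluation at a nonzero `k` is onto `E`, since it sends `k ⊗ x` to `‖k‖² x`. -/
theorem symbol_ext (hT : IsMultiplierModule T) {w : ℂ} (hw : w ∈ Metric.ball (0 : ℂ) 1)
    {A B : E →L[ℂ] G}
    (h : ∀ k ∈ eigenFibre T w, ∀ u : H ⊗[ℂ] E, A (evalAt E k u) = B (evalAt E k u)) : A = B := by
  obtain ⟨k, hk, hk0⟩ := hT.exists_ne_zero hw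
  ext x
  have := h k hk (k ⊗ₜ[ℂ] x)
  rw [evalAt_tmul, map_smul, map_smul] at this
  exact smul_right_injective _ (inner_self_ne_zero.2 hk0) this

variable [FiniteDimensional ℂ G]

theorem tensor_ext (hT : IsMultiplierModule T) {u v : H ⊗[ℂ] G}
    (h : ∀ w ∈ Metric.ball (0 : ℂ) 1, ∀ k ∈ eigenFibre T w, evalAt G k u = evalAt G k v) :
    u = v := by
  rw [← sum_componentAlong_tmul (stdOrthonormalBasis ℂ G) u,
    ← sum_componentAlong_tmul (stdOrthonormalBasis ℂ G) v]
  refine Finset.sum_congr rfl fun i _ => congrArg (· ⊗ₜ[ℂ] _) (sub_eq_zero.1 ?_)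
  refine hT.ext_fibres _ fun w hw k hk => ?_
  rw [inner_sub_right, inner_componentAlong, inner_componentAlong, h w hw k hk, sub_self]

theorem commute_of_isPointwiseProduct (hT : IsMultiplierModule T) {Φ : ℂ → E →L[ℂ] G}
    {X : H ⊗[ℂ] E →L[ℂ] H ⊗[ℂ] G} (hX : ∀ u, IsPointwiseProduct T Φ u (X u)) (u : H ⊗[ℂ] E) :
    X (T.rTensor E u) = T.rTensor G (X u) := by
  refine hT.tensor_ext fun w hw k hk => ?_
  have h1 := evalAt_rTensor hk u
  have h2 := evalAt_rTensor hk (X u)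
  rw [hX _ w hw k hk, h1, h2, map_smul, hX u w hw k hk]

variable [FiniteDimensional ℂ E] [FiniteDimensional ℂ F]

/-- The matrix entries of Φ in orthonormal bases are scalar bounded holomorphic functions; their
multipliers, tensored with matrix units, add up to the operator. -/
theorem isMultiplier (hT : IsMultiplierModule T) {Φ : ℂ → E →L[ℂ] G} (hΦ : IsHInfty Φ) :
    IsMultiplier T Φ := by
  let b := stdOrthonormalBasis ℂ E
  let d := stdOrthonormalBasis ℂ G
  have hf : ∀ i j, IsHInfty fun w => ⟪d j, Φ w (b i)⟫_ℂ := by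
    intro i j
    obtain ⟨C, hC⟩ := hΦ.bounded
    refine ⟨?_, C, fun z hz => ?_⟩
    · exact ((innerSL ℂ (d j)).differentiable.comp_differentiableOn
        (hΦ.differentiableOn.clm_apply (differentiableOn_const (b i))))
    · refine (norm_inner_le_norm _ _).trans ?_
      rw [d.norm_eq_one, one_mul]
      refine ((Φ z).le_opNorm _).trans ?_
      rw [b.norm_eq_one, mul_one]
      exact hC z hz
  choose A hA using fun i j => hT.exists_multiplier _ (hf i j)
  refine ⟨∑ i, ∑ j, TensorProduct.mapL (A i j) ((innerSL ℂ (b i)).smulRight (d j)), ?_⟩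
  intro u w hw k hk
  induction u using TensorProduct.induction_on with
  | zero => simp
  | tmul h x =>
    simp only [sum_apply, map_sum, TensorProduct.mapL_tmul, evalAt_tmul,
      ContinuousLinearMap.smulRight_apply, innerSL_apply_apply]
    simp only [hA _ _ w hw k hk]
    rw [map_smul]
    conv_rhs => rw [← b.sum_repr' x, map_sum, Finset.smul_sum]
    refine Finset.sum_congr rfl fun i _ => ?_
    rw [map_smul]
    conv_rhs => rw [← d.sum_repr' (Φ w (b i)), Finset.smul_sum, Finset.smul_sum]
    refine Finset.sum_congr rfl fun j _ => ?_
    simp only [smul_smul]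
    congr 1
    ring
  | add a c ha hc => rw [map_add, map_add, ha, hc, map_add, map_add]

/-- Every module map is multiplication by a bounded holomorphic symbol. -/
theorem exists_symbol (hT : IsMultiplierModule T) (X : H ⊗[ℂ] E →L[ℂ] H ⊗[ℂ] G)
    (hX : ∀ u, X (T.rTensor E u) = T.rTensor G (X u)) :
    ∃ Φ : ℂ → E →L[ℂ] G, IsHInfty Φ ∧ ∀ u, IsPointwiseProduct T Φ u (X u) := by
  -- As X is a module map, `h ↦ evalAt G k (X (h ⊗ x))` kills the range of `T - w`, hence its
  -- closure. That closure is the orthogonal complement of the fibre, which is the line through `k`.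
  have hvanish : ∀ w, ∀ k ∈ eigenFibre T w, Module.finrank ℂ (eigenFibre T w) = 1 → k ≠ 0 →
      ∀ h, ⟪k, h⟫_ℂ = 0 → ∀ x : E, evalAt G k (X (h ⊗ₜ[ℂ] x)) = 0 := by
    intro w k hk hfr hk0 h hkh x
    let L : H →L[ℂ] G := evalAt G k ∘L X ∘L (TensorProduct.mkL ℂ H E).flip x
    have hL : ∀ g, L g = evalAt G k (X (g ⊗ₜ[ℂ] x)) := fun g => rfl
    have hmem : h ∈ (T - w • ContinuousLinearMap.id ℂ H).range.topologicalClosure := by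
      have := ContinuousLinearMap.orthogonal_ker
        (ContinuousLinearMap.adjoint (T - w • ContinuousLinearMap.id ℂ H))
      rw [ContinuousLinearMap.adjoint_adjoint] at this
      rw [← this, Submodule.mem_orthogonal]
      intro k' hk'
      obtain ⟨c, hc⟩ := exists_smul_eq_of_finrank_eq_one hfr
        (x := ⟨k, hk⟩) (fun h => hk0 (congrArg Subtype.val h)) ⟨k', hk'⟩
      have hc' : k' = c • k := (congrArg Subtype.val hc).symm
      rw [hc', inner_smul_left, hkh, mul_zero]
    have hle : (T - w • ContinuousLinearMap.id ℂ H).range.topologicalClosure ≤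
        LinearMap.ker (L : H →ₗ[ℂ] G) := by
      refine Submodule.topologicalClosure_minimal _ ?_ L.isClosed_ker
      rintro _ ⟨g, rfl⟩
      change L (T g - w • g) = 0
      rw [map_sub, map_smul, hL, hL, ← ContinuousLinearMap.rTensor_tmul, hX, evalAt_rTensor hk,
        sub_self]
    exact hle hmem
  have hpure : ∀ w ∈ Metric.ball (0 : ℂ) 1, ∀ k ∈ eigenFibre T w, ∀ h₀ h x,
      ⟪k, h₀⟫_ℂ • evalAt G k (X (h ⊗ₜ[ℂ] x)) = ⟪k, h⟫_ℂ • evalAt G k (X (h₀ ⊗ₜ[ℂ] x)) := by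
    intro w hw k hk h₀ h x
    rcases eq_or_ne k 0 with rfl | hk0
    · simp
    have := hvanish w k hk (hT.finrank_fibre w hw) hk0 (⟪k, h₀⟫_ℂ • h - ⟪k, h⟫_ℂ • h₀)
      (by rw [inner_sub_right, inner_smul_right, inner_smul_right]; ring) x
    rw [TensorProduct.sub_tmul, map_sub, map_sub, sub_eq_zero, ← TensorProduct.smul_tmul',
      ← TensorProduct.smul_tmul', map_smul, map_smul, map_smul, map_smul] at this
    exact this
  -- Unit vectors will give `‖Φ w‖ ≤ ‖X‖`. Their choice need not be continuous in `w`: the resulting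
  -- Φ does not depend on it, and holomorphy is read off from a local section instead.
  have hex : ∀ w : ℂ, ∃ k : H, w ∈ Metric.ball (0 : ℂ) 1 → k ∈ eigenFibre T w ∧ ‖k‖ = 1 := by
    intro w
    by_cases hw : w ∈ Metric.ball (0 : ℂ) 1
    · obtain ⟨k, hk, hk0⟩ := hT.exists_ne_zero hw
      exact ⟨((‖k‖ : ℂ)⁻¹) • k, fun _ => ⟨Submodule.smul_mem _ _ hk, by
        rw [norm_smul, norm_inv, Complex.norm_real, norm_norm,
          inv_mul_cancel₀ (norm_ne_zero_iff.2 hk0)]⟩⟩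
    · exact ⟨0, fun h => absurd h hw⟩
  choose κ hκ using hex
  let Φ : ℂ → E →L[ℂ] G := fun w => evalAt G (κ w) ∘L X ∘L TensorProduct.mkL ℂ H E (κ w)
  have hΦ : ∀ w x, Φ w x = evalAt G (κ w) (X (κ w ⊗ₜ[ℂ] x)) := fun w x => rfl
  have hone : ∀ w ∈ Metric.ball (0 : ℂ) 1, ⟪κ w, κ w⟫_ℂ = 1 := fun w hw => by
    rw [inner_self_eq_norm_sq_to_K, (hκ w hw).2]; simp
  have hprod : ∀ w ∈ Metric.ball (0 : ℂ) 1, ∀ k ∈ eigenFibre T w, ∀ h x,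
      evalAt G k (X (h ⊗ₜ[ℂ] x)) = ⟪k, h⟫_ℂ • Φ w x := by
    intro w hw k hk h x
    have h0 : κ w ≠ 0 := norm_ne_zero_iff.1 (by rw [(hκ w hw).2]; exact one_ne_zero)
    obtain ⟨c, rfl⟩ := hT.exists_eq_smul hw (hκ w hw).1 h0 hk
    have := hpure w hw (κ w) (hκ w hw).1 (κ w) h x
    rw [hone w hw, one_smul] at this
    rw [evalAt_smul_left, this, inner_smul_left, mul_smul, hΦ]
  refine ⟨Φ, ⟨?_, ‖X‖, fun w hw => ?_⟩, fun u w hw k hk => ?_⟩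
  · intro w₀ hw₀
    refine DifferentiableAt.differentiableWithinAt ?_
    obtain ⟨k, hk0, hk, hd⟩ := hT.exists_section w₀ hw₀
    let b := stdOrthonormalBasis ℂ E
    let d := stdOrthonormalBasis ℂ G
    have hentry : ∀ i j, DifferentiableAt ℂ (fun w => ⟪d j, Φ w (b i)⟫_ℂ) w₀ := by
      intro i j
      have hne : ⟪k w₀, k w₀⟫_ℂ ≠ 0 := inner_self_ne_zero.2 hk0
      -- Near `w₀` the entry is a quotient of two pairings of `k w` with fixed vectors, both
      -- holomorphic at `w₀`; the denominator `⟪k w, k w₀⟫` is nonzero at `w₀`.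
      have hd' := (hd (componentAlong H (d j) (X (k w₀ ⊗ₜ[ℂ] b i)))).div (hd (k w₀)) hne
      refine hd'.congr_of_eventuallyEq ?_
      filter_upwards [hk, (hd (k w₀)).continuousAt.eventually_ne hne,
        Metric.isOpen_ball.mem_nhds hw₀] with w hkw hnew hw
      rw [Pi.div_apply, inner_componentAlong, hprod w hw _ hkw, inner_smul_right]
      field_simp
    have hsum : Φ = fun w => ∑ i, ∑ j, ⟪d j, Φ w (b i)⟫_ℂ •
        (innerSL ℂ (b i)).smulRight (d j) := by
      funext w
      ext x
      simp only [sum_apply, smul_apply, ContinuousLinearMap.smulRight_apply, innerSL_apply_apply]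
      conv_lhs => rw [← b.sum_repr' x, map_sum]
      refine Finset.sum_congr rfl fun i _ => ?_
      rw [map_smul]
      conv_lhs => rw [← d.sum_repr' (Φ w (b i)), Finset.smul_sum]
      refine Finset.sum_congr rfl fun j _ => ?_
      rw [smul_comm]
    rw [hsum]
    exact DifferentiableAt.fun_sum fun i _ => DifferentiableAt.fun_sum fun j _ =>
      (hentry i j).smul_const _
  · refine ContinuousLinearMap.opNorm_le_bound _ X.opNorm_nonneg fun x => ?_
    rw [hΦ]
    refine (norm_evalAt_le _ _).trans ?_
    rw [(hκ w hw).2, one_mul]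
    refine (X.le_opNorm _).trans ?_
    rw [TensorProduct.norm_tmul, (hκ w hw).2, one_mul]
  · induction u using TensorProduct.induction_on with
    | zero => simp
    | tmul h x => rw [hprod w hw k hk, evalAt_tmul, map_smul]
    | add a c ha hc => rw [map_add, map_add, ha, hc, map_add, map_add]

/-- Similarity of the quotient module `H_Θ` to `H ⊗ F` amounts to the existence of bounded
holomorphic functions that complement `Θ` and its left inverse, whatever the module `H` is. -/
theorem areSimilar_quotientShift_iff (hT : IsMultiplierModule T) {Θ : ℂ → E →L[ℂ] G}
    {Ψ : ℂ → G →L[ℂ] E} (hΘ : IsHInfty Θ) (hΨ : IsHInfty Ψ)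
    (hΨΘ : ∀ z ∈ Metric.ball (0 : ℂ) 1, Ψ z ∘L Θ z = ContinuousLinearMap.id ℂ _) :
    AreSimilar (quotientShift T Θ) (T.rTensor F) ↔
      ∃ (Φ : ℂ → G →L[ℂ] F) (Ω : ℂ → F →L[ℂ] G), IsHInfty Φ ∧ IsHInfty Ω ∧
        ∀ z ∈ Metric.ball (0 : ℂ) 1, Φ z ∘L Θ z = 0 ∧
          Φ z ∘L Ω z = ContinuousLinearMap.id ℂ F ∧
          Ω z ∘L Φ z = ContinuousLinearMap.id ℂ G - Θ z ∘L Ψ z := by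
  obtain ⟨A, hA⟩ := hT.isMultiplier hΘ
  obtain ⟨B, hB⟩ := hT.isMultiplier hΨ
  have hΨΘ' : ∀ z ∈ Metric.ball (0 : ℂ) 1, ∀ x, Ψ z (Θ z x) = x := fun z hz x =>
    congrArg (fun L : E →L[ℂ] E => L x) (hΨΘ z hz)
  let π := (mulRange T Θ).mkQL
  have hπ0 : ∀ u, u ∈ mulRange T Θ → π u = 0 := fun u hu =>
    (Submodule.Quotient.mk_eq_zero _).2 hu
  have hπA : ∀ u, π (A u) = 0 := fun u => hπ0 _ ⟨u, hA u⟩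
  have hπS : ∀ u, quotientShift T Θ (π u) = π (T.rTensor G u) := fun u => rfl
  have hπsurj : ∀ v, ∃ u, π u = v := Submodule.Quotient.mk_surjective _
  constructor
  · rintro ⟨X, hX⟩
    -- P kills the range of multiplication by Θ, so it descends to a map Q on the quotient. As `π ∘
    -- A = 0`, Q is a bounded section of π.
    let P : H ⊗[ℂ] G →L[ℂ] H ⊗[ℂ] G := ContinuousLinearMap.id ℂ _ - A ∘L B
    have hP : ∀ u, P u = u - A (B u) := fun u => rfl
    have hP0 : ∀ u ∈ mulRange T Θ, P u = 0 := by
      rintro u ⟨h, hh⟩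
      refine hT.tensor_ext fun w hw k hk => ?_
      rw [hP, map_sub, hA _ w hw k hk, hB _ w hw k hk, hh w hw k hk, hΨΘ' w hw, sub_self, map_zero]
    have hPT : ∀ u, P (T.rTensor G u) = T.rTensor G (P u) := fun u => by
      rw [hP, hP, hT.commute_of_isPointwiseProduct hB, hT.commute_of_isPointwiseProduct hA, map_sub]
    let Q := (mulRange T Θ).liftQL P hP0
    have hQ : ∀ u, Q (π u) = P u := fun u => rfl
    let Φ' : H ⊗[ℂ] G →L[ℂ] H ⊗[ℂ] F := (X : _ →L[ℂ] H ⊗[ℂ] F) ∘L π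
    let Ω' : H ⊗[ℂ] F →L[ℂ] H ⊗[ℂ] G := Q ∘L (X.symm : H ⊗[ℂ] F →L[ℂ] _)
    have hΦ' : ∀ u, Φ' u = X (π u) := fun u => rfl
    have hΩ' : ∀ u, Ω' u = Q (X.symm u) := fun u => rfl
    obtain ⟨Φ, hΦ, hΦm⟩ := hT.exists_symbol Φ' fun u => by
      rw [hΦ', hΦ', ← hπS, hX]
    obtain ⟨Ω, hΩ, hΩm⟩ := hT.exists_symbol Ω' fun u => by
      obtain ⟨v, hv⟩ := hπsurj (X.symm u)
      have h1 : X.symm (T.rTensor F u) = quotientShift T Θ (X.symm u) := by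
        rw [ContinuousLinearEquiv.symm_apply_eq, hX, ContinuousLinearEquiv.apply_symm_apply]
      rw [hΩ', hΩ', h1, ← hv, hπS, hQ, hQ, hPT]
    refine ⟨Φ, Ω, hΦ, hΩ, fun z hz => ⟨?_, ?_, ?_⟩⟩
    · refine hT.symbol_ext hz fun k hk u => ?_
      rw [ContinuousLinearMap.comp_apply, ← hA u z hz k hk, ← hΦm _ z hz k hk, hΦ', hπA,
        map_zero, map_zero, zero_apply]
    · refine hT.symbol_ext hz fun k hk u => ?_
      rw [ContinuousLinearMap.comp_apply, ← hΩm u z hz k hk, ← hΦm _ z hz k hk, hΦ', hΩ']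
      obtain ⟨v, hv⟩ := hπsurj (X.symm u)
      rw [← hv, hQ, hP, map_sub, hπA, sub_zero, hv, ContinuousLinearEquiv.apply_symm_apply,
        ContinuousLinearMap.id_apply]
    · refine hT.symbol_ext hz fun k hk u => ?_
      rw [ContinuousLinearMap.comp_apply, ← hΦm u z hz k hk, ← hΩm _ z hz k hk, hΩ', hΦ',
        ContinuousLinearEquiv.symm_apply_apply, hQ, hP, map_sub, hA _ z hz k hk, hB _ z hz k hk]
      rfl
  · rintro ⟨Φ, Ω, hΦ, hΩ, hid⟩
    obtain ⟨M, hM⟩ := hT.isMultiplier hΦ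
    obtain ⟨N, hN⟩ := hT.isMultiplier hΩ
    have h1 : ∀ z ∈ Metric.ball (0 : ℂ) 1, ∀ x, Φ z (Θ z x) = 0 := fun z hz x =>
      congrArg (fun L : E →L[ℂ] F => L x) (hid z hz).1
    have h2 : ∀ z ∈ Metric.ball (0 : ℂ) 1, ∀ x, Φ z (Ω z x) = x := fun z hz x =>
      congrArg (fun L : F →L[ℂ] F => L x) (hid z hz).2.1
    have h3 : ∀ z ∈ Metric.ball (0 : ℂ) 1, ∀ x, Ω z (Φ z x) = x - Θ z (Ψ z x) := fun z hz x =>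
      congrArg (fun L : G →L[ℂ] G => L x) (hid z hz).2.2
    have hM0 : ∀ u ∈ mulRange T Θ, M u = 0 := by
      rintro u ⟨h, hh⟩
      refine hT.tensor_ext fun w hw k hk => ?_
      rw [hM _ w hw k hk, hh w hw k hk, h1 w hw, map_zero]
    have hMN : ∀ u, M (N u) = u := fun u => hT.tensor_ext fun w hw k hk => by
      rw [hM _ w hw k hk, hN _ w hw k hk, h2 w hw]
    have hNM : ∀ u, N (M u) = u - A (B u) := fun u => hT.tensor_ext fun w hw k hk => by
      rw [hN _ w hw k hk, hM _ w hw k hk, h3 w hw, map_sub, hA _ w hw k hk, hB _ w hw k hk]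
    let Y := (mulRange T Θ).liftQL M hM0
    have hY : ∀ u, Y (π u) = M u := fun u => rfl
    refine ⟨ContinuousLinearEquiv.equivOfInverse Y (π ∘L N) (fun v => ?_) (fun u => ?_),
      fun v => ?_⟩
    · obtain ⟨u, rfl⟩ := hπsurj v
      rw [hY, ContinuousLinearMap.comp_apply, hNM, map_sub, hπA, sub_zero]
    · rw [ContinuousLinearMap.comp_apply, hY, hMN]
    · obtain ⟨u, rfl⟩ := hπsurj v
      rw [ContinuousLinearEquiv.equivOfInverse_apply, ContinuousLinearEquiv.equivOfInverse_apply,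
        hπS, hY, hY, hT.commute_of_isPointwiseProduct hM]

end IsMultiplierModule

end MultiplierModules

/-! ### Modules over the disk algebra: left inverses and local sections -/

section DiskAlgebraModules

variable {H : Type*} [NormedAddCommGroup H] [InnerProductSpace ℂ H] [CompleteSpace H]

namespace IsCowenDouglasDual

variable {T : H →L[ℂ] H}

theorem ext_fibres {m : ℕ} {U : Set ℂ} (hT : IsCowenDouglasDual m U T) (h : H)
    (hh : ∀ w ∈ U, ∀ k ∈ eigenFibre T w, ⟪k, h⟫_ℂ = 0) : h = 0 := by
  have h1 := Submodule.topologicalClosure_eq_top_iff.1 hT.span_fibres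
  have h2 : (⨆ w ∈ U, eigenFibre T w) ≤ LinearMap.ker (innerSL ℂ h : H →ₗ[ℂ] ℂ) :=
    iSup₂_le fun w hw k hk => inner_eq_zero_symm.1 (hh w hw k hk)
  have h3 : h ∈ (⨆ w ∈ U, eigenFibre T w)ᗮ :=
    (Submodule.mem_orthogonal _ _).2 fun u hu => inner_eq_zero_symm.1 (h2 hu)
  rwa [h1, Submodule.mem_bot] at h3

/-- An eigenvector at `w₀` is orthogonal to the fibres at all other points, so only the fibre at
`w₀` matters. By closed range and the open mapping theorem, a vector of the fibre at `w₀ + t` is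
within O(t), relative to its norm, of the fibre at `w₀`. Thus orthogonality passes to the limit `t →
0`, and density of the fibres finishes. -/
theorem eigenvector_eq_zero (hT : IsCowenDouglasDual 1 (Metric.ball (0 : ℂ) 1) T) {w₀ : ℂ}
    (hw₀ : w₀ ∈ Metric.ball (0 : ℂ) 1) {h : H} (hh : T h = w₀ • h) : h = 0 := by
  have hne : ∀ w ∈ Metric.ball (0 : ℂ) 1, w ≠ w₀ → ∀ k ∈ eigenFibre T w, ⟪k, h⟫_ℂ = 0 := by
    intro w hw hww k hk
    have h1 := mem_eigenFibre_iff.1 hk h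
    rw [hh, inner_smul_right] at h1
    have h2 : (w₀ - w) * ⟪k, h⟫_ℂ = 0 := by linear_combination h1
    exact (mul_eq_zero.1 h2).resolve_left (sub_ne_zero.2 hww.symm)
  refine hT.ext_fibres h fun w hw k hk => ?_
  rcases eq_or_ne w w₀ with rfl | hww
  swap
  · exact hne w hw hww k hk
  by_contra hkh
  have hk0 : k ≠ 0 := by rintro rfl; simp at hkh
  set A := ContinuousLinearMap.adjoint (T - w • ContinuousLinearMap.id ℂ H) with hA
  have hcl : IsClosed (A.range : Set H) := hT.isClosed_range w hw
  have := hcl.completeSpace_coe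
  obtain ⟨C, hC, hpre⟩ := A.rangeRestrict.exists_preimage_norm_le
    (LinearMap.surjective_rangeRestrict _)
  have ha : 0 < ‖⟪k, h⟫_ℂ‖ := norm_pos_iff.2 hkh
  have hfib : ∀ t : ℝ, 0 < t → w + t ∈ Metric.ball (0 : ℂ) 1 →
      ‖⟪k, h⟫_ℂ‖ * (1 - C * t) ≤ ‖k‖ * (C * t * ‖h‖) := by
    intro t ht hwt
    have hwt' : w + t ≠ w := by simpa using ht.ne'
    obtain ⟨κ, hκ0, -⟩ := finrank_eq_one_iff'.1 (hT.finrank_fibre (w + t) hwt)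
    obtain ⟨x, hx, hx0⟩ : ∃ x ∈ eigenFibre T (w + t), x ≠ 0 :=
      ⟨κ, κ.2, fun h => hκ0 (Subtype.ext h)⟩
    have hAx : A x = (t : ℂ) • x := by
      refine ext_inner_right ℂ fun g => ?_
      rw [hA, ContinuousLinearMap.adjoint_inner_left, inner_smul_left, Complex.conj_ofReal]
      have := mem_eigenFibre_iff.1 hx g
      simp only [sub_apply, smul_apply, ContinuousLinearMap.id_apply, inner_sub_right,
        inner_smul_right, this]
      ring
    obtain ⟨y, hy, hyn⟩ := hpre (A.rangeRestrict x)
    have hy' : A y = A x := congrArg Subtype.val hy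
    have hyn' : ‖y‖ ≤ C * (t * ‖x‖) := by
      refine hyn.trans_eq ?_
      have : ‖A.rangeRestrict x‖ = ‖A x‖ := rfl
      rw [this, hAx, norm_smul, Complex.norm_real, Real.norm_of_nonneg ht.le]
    have hxy : x - y ∈ eigenFibre T w := by
      refine LinearMap.mem_ker.2 ?_
      change A (x - y) = 0
      rw [map_sub, hy', sub_self]
    obtain ⟨c, hc⟩ := exists_smul_eq_of_finrank_eq_one (hT.finrank_fibre w hw)
      (x := ⟨k, hk⟩) (fun h => hk0 (congrArg Subtype.val h)) ⟨x - y, hxy⟩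
    have hc' : c • k = x - y := congrArg Subtype.val hc
    have h1 : ⟪x, h⟫_ℂ = 0 := hne _ hwt hwt' x hx
    have h2 : ‖c‖ * ‖⟪k, h⟫_ℂ‖ ≤ C * (t * ‖x‖) * ‖h‖ := by
      have : starRingEnd ℂ c * ⟪k, h⟫_ℂ = -⟪y, h⟫_ℂ := by
        rw [← inner_smul_left, hc', inner_sub_left, h1, zero_sub]
      calc ‖c‖ * ‖⟪k, h⟫_ℂ‖ = ‖⟪y, h⟫_ℂ‖ := by
            rw [← RCLike.norm_conj c, ← norm_mul, this, norm_neg]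
        _ ≤ ‖y‖ * ‖h‖ := norm_inner_le_norm _ _
        _ ≤ _ := by gcongr
    have h3 : ‖x‖ * (1 - C * t) ≤ ‖c‖ * ‖k‖ := by
      rw [← norm_smul, hc']
      have := norm_sub_norm_le x y
      nlinarith
    have hx0' : 0 < ‖x‖ := norm_pos_iff.2 hx0
    refine le_of_mul_le_mul_left ?_ hx0'
    calc ‖x‖ * (‖⟪k, h⟫_ℂ‖ * (1 - C * t)) = (‖x‖ * (1 - C * t)) * ‖⟪k, h⟫_ℂ‖ := by ring
      _ ≤ (‖c‖ * ‖k‖) * ‖⟪k, h⟫_ℂ‖ := by gcongr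
      _ = ‖k‖ * (‖c‖ * ‖⟪k, h⟫_ℂ‖) := by ring
      _ ≤ ‖k‖ * (C * (t * ‖x‖) * ‖h‖) := by gcongr
      _ = _ := by ring
  have hlim : Filter.Tendsto (fun t : ℝ => ‖⟪k, h⟫_ℂ‖ * (1 - C * t) - ‖k‖ * (C * t * ‖h‖))
      (nhdsWithin 0 (Set.Ioi 0)) (nhds ‖⟪k, h⟫_ℂ‖) := by
    have : Continuous fun t : ℝ => ‖⟪k, h⟫_ℂ‖ * (1 - C * t) - ‖k‖ * (C * t * ‖h‖) := by fun_prop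
    have h0 := this.tendsto 0
    simp only [mul_zero, sub_zero, mul_one, zero_mul] at h0
    exact h0.mono_left nhdsWithin_le_nhds
  have hball : ∀ᶠ t : ℝ in nhdsWithin 0 (Set.Ioi 0), w + t ∈ Metric.ball (0 : ℂ) 1 := by
    have : Continuous fun t : ℝ => w + (t : ℂ) := by fun_prop
    have h0 := this.tendsto 0
    simp only [Complex.ofReal_zero, add_zero] at h0
    exact (h0.mono_left nhdsWithin_le_nhds) (Metric.isOpen_ball.mem_nhds hw)
  obtain ⟨t, ht1, ht2, ht3⟩ := (hlim.eventually_const_lt ha |>.and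
    (hball.and self_mem_nhdsWithin)).exists
  linarith [hfib t ht3 ht2]

/-- The adjoint of `T - w` has closed range, and this range is dense because `T - w` is injective;
so the adjoint is onto. By duality `T - w` is bounded below, and the orthogonal projection onto its
closed range provides the left inverse. -/
theorem exists_leftInverse (hT : IsCowenDouglasDual 1 (Metric.ball (0 : ℂ) 1) T) {w : ℂ}
    (hw : w ∈ Metric.ball (0 : ℂ) 1) : ∃ L : H →L[ℂ] H, ∀ h, L (T h - w • h) = h := by
  set B := T - w • ContinuousLinearMap.id ℂ H
  set A := ContinuousLinearMap.adjoint B with hA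
  have hcl : IsClosed (A.range : Set H) := hT.isClosed_range w hw
  have hsurj : A.range = ⊤ := by
    rw [← hcl.submodule_topologicalClosure_eq, Submodule.topologicalClosure_eq_top_iff,
      ContinuousLinearMap.orthogonal_range, hA, ContinuousLinearMap.adjoint_adjoint, eq_bot_iff]
    intro h hh
    refine (Submodule.mem_bot ℂ).2 (hT.eigenvector_eq_zero hw (sub_eq_zero.1 ?_))
    exact hh
  obtain ⟨C, hC, hpre⟩ := A.exists_preimage_norm_le (LinearMap.range_eq_top.1 hsurj)
  have hanti : AntilipschitzWith ⟨C, hC.le⟩ B := by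
    refine ContinuousLinearMap.antilipschitz_of_bound B fun x => ?_
    obtain ⟨y, hy, hyn⟩ := hpre x
    rcases eq_or_ne x 0 with rfl | hx
    · simp
    have hx0 : 0 < ‖x‖ := norm_pos_iff.2 hx
    refine le_of_mul_le_mul_left ?_ hx0
    calc ‖x‖ * ‖x‖ = ‖⟪x, x⟫_ℂ‖ := by
            rw [inner_self_eq_norm_sq_to_K, norm_pow, RCLike.norm_ofReal, abs_norm, sq]
      _ = ‖⟪y, B x⟫_ℂ‖ := by
        conv_lhs => rw [← hy]
        rw [hy, ← ContinuousLinearMap.adjoint_inner_left, ← hA, hy]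
      _ ≤ ‖y‖ * ‖B x‖ := norm_inner_le_norm _ _
      _ ≤ (C * ‖x‖) * ‖B x‖ := by gcongr
      _ = ‖x‖ * (C * ‖B x‖) := by ring
  have hclB : IsClosed (Set.range B) := hanti.isClosed_range B.uniformContinuous
  have hclB' : IsClosed (B.range : Set H) := hclB
  have := hclB'.completeSpace_coe
  have hcompl : Submodule.ClosedComplemented B.range :=
    ⟨B.range.orthogonalProjectionOnto, fun x => by simp⟩
  obtain ⟨L, hL⟩ :=
    (ContinuousLinearMap.HasLeftInverse.of_injective_of_isClosed_range_of_closedComplement_range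
      hanti.injective hclB hcompl : B.HasLeftInverse)
  exact ⟨L, hL⟩

/-- If `L (T - w₀) = 1` then `T - w = (1 - (w - w₀) L) (T - w₀)`. Hence the adjoint of `(1 - (w -
w₀) L)⁻¹` carries the fibre at `w₀` into the fibre at `w`, for `w` near `w₀`. -/
theorem exists_section (hT : IsCowenDouglasDual 1 (Metric.ball (0 : ℂ) 1) T) {w₀ : ℂ}
    (hw₀ : w₀ ∈ Metric.ball (0 : ℂ) 1) : ∃ k : ℂ → H, k w₀ ≠ 0 ∧
      (∀ᶠ w in nhds w₀, k w ∈ eigenFibre T w) ∧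
      ∀ h, DifferentiableAt ℂ (fun w => ⟪k w, h⟫_ℂ) w₀ := by
  obtain ⟨L, hL⟩ := hT.exists_leftInverse hw₀
  obtain ⟨κ, hκ0, -⟩ := finrank_eq_one_iff'.1 (hT.finrank_fibre w₀ hw₀)
  obtain ⟨k₀, hk₀, hk₀'⟩ : ∃ x ∈ eigenFibre T w₀, x ≠ 0 :=
    ⟨κ, κ.2, fun h => hκ0 (Subtype.ext h)⟩
  let R : ℂ → H →L[ℂ] H := fun w => 1 - (w - w₀) • L
  have hRd : Differentiable ℂ R := by fun_prop
  have hR0 : R w₀ = 1 := by simp [R]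
  have hRu : ∀ᶠ w in nhds w₀, IsUnit (R w) := by
    have := hRd.continuous.tendsto w₀
    rw [hR0] at this
    exact this (Units.isOpen.mem_nhds isUnit_one)
  refine ⟨fun w => ContinuousLinearMap.adjoint (Ring.inverse (R w)) k₀, ?_, ?_, fun h => ?_⟩
  · change ContinuousLinearMap.adjoint (Ring.inverse (R w₀)) k₀ ≠ 0
    rw [hR0, Ring.inverse_one, show (1 : H →L[ℂ] H) = ContinuousLinearMap.id ℂ H from rfl,
      ContinuousLinearMap.adjoint_id]
    exact hk₀'
  · filter_upwards [hRu] with w hw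
    refine mem_eigenFibre_iff.2 fun h => ?_
    rw [ContinuousLinearMap.adjoint_inner_left, ContinuousLinearMap.adjoint_inner_left]
    have h1 : T h - w • h = R w (T h - w₀ • h) := by
      simp only [R, sub_apply, smul_apply, one_apply_eq_self, hL]
      module
    have h2 : Ring.inverse (R w) (T h - w • h) = T h - w₀ • h := by
      rw [h1, ← mul_apply_eq_comp, Ring.inverse_mul_cancel _ hw,
        one_apply_eq_self]
    have h3 := congrArg (fun x => ⟪k₀, x⟫_ℂ) h2
    simp only [map_sub, map_smul, inner_sub_right, inner_smul_right,
      mem_eigenFibre_iff.1 hk₀ h, sub_self] at h3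
    exact sub_eq_zero.1 h3
  · simp only [ContinuousLinearMap.adjoint_inner_left]
    have h1 : DifferentiableAt ℂ (fun w => Ring.inverse (R w)) w₀ :=
      DifferentiableAt.comp (g := Ring.inverse) w₀
        (differentiableAt_inverse (by rw [hR0]; exact isUnit_one)) (hRd w₀)
    exact ((innerSL ℂ k₀).differentiableAt).comp w₀ (h1.clm_apply (differentiableAt_const h))

end IsCowenDouglasDual

/-! ### Bounded holomorphic functions as multipliers, by dilation -/

/-- A bounded sequence of operators that converges on a set of vectors with dense span converges
strongly. -/
theorem exists_strong_limit {V : Type*} [NormedAddCommGroup V] [NormedSpace ℂ V] [CompleteSpace V]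
    (B : ℕ → V →L[ℂ] V) {C : ℝ} (hC : ∀ n, ‖B n‖ ≤ C) {S : Submodule ℂ V}
    (hS : S.topologicalClosure = ⊤)
    (hconv : ∀ x ∈ S, ∃ y, Filter.Tendsto (fun n => B n x) Filter.atTop (nhds y)) :
    ∃ A : V →L[ℂ] V, ∀ x, Filter.Tendsto (fun n => B n x) Filter.atTop (nhds (A x)) := by
  have hC0 : 0 ≤ C := (norm_nonneg _).trans (hC 0)
  have hcauchy : ∀ x, CauchySeq fun n => B n x := by
    intro x
    rw [Metric.cauchySeq_iff']
    intro ε hε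
    have hx : x ∈ closure (S : Set V) := by
      have : x ∈ S.topologicalClosure := hS ▸ Submodule.mem_top
      exact this
    -- `C + 1` rather than `C`, since `C` may be zero.
    obtain ⟨y, hy, hxy⟩ := Metric.mem_closure_iff.1 hx (ε / (4 * (C + 1))) (by positivity)
    obtain ⟨z, hz⟩ := hconv y hy
    obtain ⟨N, hN⟩ := Metric.cauchySeq_iff'.1 hz.cauchySeq (ε / 2) (half_pos hε)
    refine ⟨N, fun n hn => ?_⟩
    have hb : ∀ m, dist (B m x) (B m y) ≤ ε / 4 := fun m => by
      rw [dist_eq_norm, ← map_sub]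
      refine ((B m).le_of_opNorm_le (hC m) _).trans ?_
      rw [← dist_eq_norm]
      calc C * dist x y ≤ (C + 1) * (ε / (4 * (C + 1))) := by
            gcongr
            linarith
        _ = ε / 4 := by field_simp
    calc dist (B n x) (B N x) ≤ dist (B n x) (B n y) + dist (B n y) (B N y) +
          dist (B N y) (B N x) := dist_triangle4 _ _ _ _
      _ < ε / 4 + ε / 2 + ε / 4 := by
        have h1 := hb n
        have h2 := hb N
        rw [dist_comm] at h2
        have h3 := hN n hn
        linarith
      _ = ε := by ring
  choose A hA using fun x => cauchySeq_tendsto_of_complete (hcauchy x)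
  exact ⟨continuousLinearMapOfTendsto B (tendsto_pi_nhds.2 hA), hA⟩

/-- The dilation `z ↦ f (r z)`, `r < 1`, of a holomorphic function on the disk. -/
def DiskAlgebra.dilate {f : ℂ → ℂ} (hf : DifferentiableOn ℂ f (Metric.ball 0 1)) {r : ℝ}
    (hr0 : 0 ≤ r) (hr1 : r < 1) : DiskAlgebra :=
  have hmem : ∀ z : ℂ, ‖z‖ ≤ 1 → (r : ℂ) * z ∈ Metric.ball (0 : ℂ) 1 := fun z hz => by
    rw [mem_ball_zero_iff, norm_mul, Complex.norm_real, Real.norm_of_nonneg hr0]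
    nlinarith [norm_nonneg z]
  ⟨⟨fun z => f (r * z), hf.continuousOn.comp_continuous (by fun_prop)
      fun z => hmem z (mem_closedBall_zero_iff.1 z.2)⟩,
    fun z => f (r * z), hf.comp (by fun_prop) fun z hz => hmem z (mem_ball_zero_iff.1 hz).le,
    fun _ _ => rfl⟩

/-- The quotient is the difference quotient of `f` at `w`, filled in by the derivative. It stays
continuous up to the circle because `w` is an interior point. -/
theorem DiskAlgebra.exists_sub_eq_mul (f : DiskAlgebra) (w : ℂ) (hw : w ∈ Metric.ball (0 : ℂ) 1) :
    ∃ g : DiskAlgebra, f - algebraMap ℂ _ ((f : C(Metric.closedBall (0 : ℂ) 1, ℂ))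
      ⟨w, Metric.ball_subset_closedBall hw⟩) = (DiskAlgebra.coord - algebraMap ℂ _ w) * g := by
  obtain ⟨f, f', hf', hff'⟩ := f
  let e : ℂ → ℂ := Function.extend Subtype.val f 0
  have he : ∀ z : Metric.closedBall (0 : ℂ) 1, e z = f z :=
    fun z => Subtype.val_injective.extend_apply f 0 z
  have hec : ContinuousOn e (Metric.closedBall 0 1) := by
    rw [continuousOn_iff_continuous_domRestrict]
    exact f.continuous.congr fun z => (he z).symm
  have hed : DifferentiableOn ℂ e (Metric.ball 0 1) := hf'.congr fun z hz =>
    (he ⟨z, Metric.ball_subset_closedBall hz⟩).trans (hff' _ hz)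
  have hnhds : Metric.ball (0 : ℂ) 1 ∈ nhds w := Metric.isOpen_ball.mem_nhds hw
  have hgc : ContinuousOn (dslope e w) (Metric.closedBall 0 1) :=
    (continuousOn_dslope (Filter.mem_of_superset hnhds Metric.ball_subset_closedBall)).2
      ⟨hec, hed.differentiableAt hnhds⟩
  have hgd : DifferentiableOn ℂ (dslope e w) (Metric.ball 0 1) :=
    (Complex.differentiableOn_dslope hnhds).2 hed
  refine ⟨⟨⟨fun z => dslope e w z, continuousOn_iff_continuous_domRestrict.1 hgc⟩, dslope e w, hgd,
    fun _ _ => rfl⟩, Subtype.ext (ContinuousMap.ext fun z => ?_)⟩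
  have h1 := sub_smul_dslope e w z
  have h2 := he ⟨w, Metric.ball_subset_closedBall hw⟩
  simp only at h2
  rw [he, h2] at h1
  exact h1.symm

/-- Writing `f - f(w) = (z - w) g`, the range of `ρ f - f(w)` lies in that of `T - w`, to which `k`
is orthogonal. -/
theorem inner_eigenFibre_map (ρ : DiskAlgebra →A[ℂ] (H →L[ℂ] H)) (f : DiskAlgebra) (w : ℂ)
    (hw : w ∈ Metric.ball (0 : ℂ) 1) (k : H) (hk : k ∈ eigenFibre (ρ DiskAlgebra.coord) w)
    (h : H) : ⟪k, ρ f h⟫_ℂ = (f : C(Metric.closedBall (0 : ℂ) 1, ℂ))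
      ⟨w, Metric.ball_subset_closedBall hw⟩ * ⟪k, h⟫_ℂ := by
  obtain ⟨g, hg⟩ := DiskAlgebra.exists_sub_eq_mul f w hw
  have h1 := congrArg (fun x => ⟪k, ρ x h⟫_ℂ) hg
  simp only [map_sub, map_mul, sub_apply, mul_apply_eq_comp,
    inner_sub_right, AlgHomClass.commutes, ContinuousLinearMap.algebraMap_apply, inner_smul_right,
    mem_eigenFibre_iff.1 hk, sub_self] at h1
  exact sub_eq_zero.1 h1

/-- `f` need not extend continuously to the closed disk, but its dilations do, with the same bound.
The adjoints of their images are uniformly bounded and act on each fibre by convergent scalars, so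
they converge strongly; the multiplier is the adjoint of the limit. -/
theorem exists_multiplier_of_diskAlgebra (ρ : DiskAlgebra →A[ℂ] (H →L[ℂ] H)) {m : ℕ}
    (hT : IsCowenDouglasDual m (Metric.ball (0 : ℂ) 1) (ρ DiskAlgebra.coord)) {f : ℂ → ℂ}
    (hf : IsHInfty f) : ∃ A : H →L[ℂ] H, ∀ w ∈ Metric.ball (0 : ℂ) 1,
      ∀ k ∈ eigenFibre (ρ DiskAlgebra.coord) w, ∀ h, ⟪k, A h⟫_ℂ = f w * ⟪k, h⟫_ℂ := by
  obtain ⟨C, hC⟩ := hf.bounded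
  let r : ℕ → ℝ := fun n => 1 - 1 / ((n : ℝ) + 1)
  have hr0 : ∀ n, 0 ≤ r n := fun n => by
    have : 1 / ((n : ℝ) + 1) ≤ 1 := by
      rw [div_le_one (by positivity)]
      linarith [n.cast_nonneg (α := ℝ)]
    simp only [r]
    linarith
  have hr1 : ∀ n, r n < 1 := fun n => by
    have : 0 < 1 / ((n : ℝ) + 1) := by positivity
    simp only [r]
    linarith
  have hrlim : Filter.Tendsto r Filter.atTop (nhds 1) := by
    simpa only [sub_zero] using
      (tendsto_one_div_add_atTop_nhds_zero_nat (𝕜 := ℝ)).const_sub (1 : ℝ)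
  let φ : ℕ → DiskAlgebra := fun n => DiskAlgebra.dilate hf.differentiableOn (hr0 n) (hr1 n)
  have hball : ∀ n (z : ℂ), ‖z‖ ≤ 1 → (r n : ℂ) * z ∈ Metric.ball (0 : ℂ) 1 := fun n z hz => by
    rw [mem_ball_zero_iff, norm_mul, Complex.norm_real, Real.norm_of_nonneg (hr0 n)]
    nlinarith [norm_nonneg z, hr0 n, hr1 n]
  have hC0 : 0 ≤ C := (norm_nonneg _).trans (hC 0 (by simp))
  have hφ : ∀ n, ‖φ n‖ ≤ C := fun n =>
    (ContinuousMap.norm_le _ hC0).2 fun z => hC _ (hball n z (mem_closedBall_zero_iff.1 z.2))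
  let B : ℕ → H →L[ℂ] H := fun n => ContinuousLinearMap.adjoint (ρ (φ n))
  have hB : ∀ n, ‖B n‖ ≤ ‖ρ.toContinuousLinearMap‖ * C := fun n => by
    rw [LinearIsometryEquiv.norm_map]
    refine (ρ.toContinuousLinearMap.le_opNorm (φ n)).trans ?_
    gcongr
    exact hφ n
  have hfib : ∀ w ∈ Metric.ball (0 : ℂ) 1, ∀ k ∈ eigenFibre (ρ DiskAlgebra.coord) w,
      Filter.Tendsto (fun n => B n k) Filter.atTop (nhds (starRingEnd ℂ (f w) • k)) := by
    intro w hw k hk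
    have h1 : ∀ n, B n k = starRingEnd ℂ (f (r n * w)) • k := fun n => by
      refine ext_inner_right ℂ fun h => ?_
      rw [ContinuousLinearMap.adjoint_inner_left, inner_eigenFibre_map ρ _ w hw k hk,
        inner_smul_left, Complex.conj_conj]
      rfl
    simp only [h1]
    have h2 : Filter.Tendsto (fun n => (r n : ℂ) * w) Filter.atTop (nhds w) := by
      have := ((Complex.continuous_ofReal.tendsto 1).comp hrlim).mul_const w
      simpa using this
    have h3 : ContinuousAt f w :=
      (hf.differentiableOn.differentiableAt (Metric.isOpen_ball.mem_nhds hw)).continuousAt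
    exact ((Complex.continuous_conj.tendsto _).comp (h3.tendsto.comp h2)).smul_const k
  obtain ⟨A, hA⟩ := exists_strong_limit B hB hT.span_fibres <| by
    let conv : Submodule ℂ H :=
      { carrier := {x | ∃ y, Filter.Tendsto (fun n => B n x) Filter.atTop (nhds y)}
        add_mem' := by
          rintro a b ⟨x, hx⟩ ⟨y, hy⟩
          exact ⟨x + y, by simpa only [map_add] using hx.add hy⟩
        zero_mem' := ⟨0, by simp⟩
        smul_mem' := by
          rintro c a ⟨x, hx⟩
          exact ⟨c • x, by simpa only [map_smul] using hx.const_smul c⟩ }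
    have hle : (⨆ w ∈ Metric.ball (0 : ℂ) 1, eigenFibre (ρ DiskAlgebra.coord) w) ≤ conv :=
      iSup₂_le fun w hw k hk => ⟨_, hfib w hw k hk⟩
    exact hle
  refine ⟨ContinuousLinearMap.adjoint A, fun w hw k hk h => ?_⟩
  rw [ContinuousLinearMap.adjoint_inner_right, tendsto_nhds_unique (hA k) (hfib w hw k hk),
    inner_smul_left, Complex.conj_conj]

theorem isMultiplierModule_of_diskAlgebra (ρ : DiskAlgebra →A[ℂ] (H →L[ℂ] H))
    (hT : IsCowenDouglasDual 1 (Metric.ball (0 : ℂ) 1) (ρ DiskAlgebra.coord)) :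
    IsMultiplierModule (ρ DiskAlgebra.coord) where
  finrank_fibre := hT.finrank_fibre
  ext_fibres := hT.ext_fibres
  exists_section _ hw := hT.exists_section hw
  exists_multiplier _ hf := exists_multiplier_of_diskAlgebra ρ hT hf

end DiskAlgebraModules

/-! ### Parseval on circles and comparison of Hardy norms -/

theorem hasSum_sq_of_hasSum_fourier {a : ℕ → ℂ} (ha : Summable fun n => ‖a n‖)
    (φ : C(UnitAddCircle, ℂ)) (hφ : ∀ x, HasSum (fun n : ℕ => a n * fourier (n : ℤ) x) (φ x)) :
    HasSum (fun n => ‖a n‖ ^ 2)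
      (‖ContinuousMap.toLp (E := ℂ) 2 AddCircle.haarAddCircle ℂ φ‖ ^ 2) := by
  have h1 : Summable fun n : ℕ => a n • (fourier (n : ℤ) : C(UnitAddCircle, ℂ)) :=
    Summable.of_norm (by simpa [norm_smul, fourier_norm] using ha)
  have h2 : HasSum (fun n : ℕ => a n • (fourier (n : ℤ) : C(UnitAddCircle, ℂ))) φ := by
    convert h1.hasSum
    ext x
    have h3 := (ContinuousMap.evalCLM ℂ x).hasSum h1.hasSum
    exact (hφ x).unique h3
  have h4 : HasSum (fun n : ℕ => a n • (fourierLp 2 (n : ℤ) : MeasureTheory.Lp ℂ 2 _))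
      (ContinuousMap.toLp (E := ℂ) 2 AddCircle.haarAddCircle ℂ φ) := by
    have := (ContinuousMap.toLp (E := ℂ) 2 (AddCircle.haarAddCircle (T := 1)) ℂ).hasSum h2
    simpa only [map_smul] using this
  have horth : Orthonormal ℂ fun n : ℕ =>
      (fourierLp 2 (n : ℤ) : MeasureTheory.Lp ℂ 2 (AddCircle.haarAddCircle (T := 1))) :=
    orthonormal_fourier.comp _ Nat.cast_injective
  refine (h4.norm.pow 2).congr fun s => ?_
  have h5 := horth.inner_sum a a s
  rw [inner_self_eq_norm_sq_to_K] at h5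
  have h6 : ∀ n, starRingEnd ℂ (a n) * a n = ((‖a n‖ ^ 2 : ℝ) : ℂ) := fun n => by
    rw [mul_comm, Complex.mul_conj, Complex.normSq_eq_norm_sq]
  simp only [h6] at h5
  refine Complex.ofReal_injective ?_
  rw [Complex.ofReal_pow, Complex.ofReal_sum]
  exact h5

/-- If holomorphic functions on the disk satisfy `|u| ≤ C |v|`, then so do the Hardy norms. -/
theorem sum_sq_le_of_norm_le {u v : ℂ → ℂ} {a b : ℕ → ℂ} {C : ℝ}
    (hu : ∀ z ∈ Metric.ball (0 : ℂ) 1, HasSum (fun n => a n * z ^ n) (u z))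
    (hv : ∀ z ∈ Metric.ball (0 : ℂ) 1, HasSum (fun n => b n * z ^ n) (v z))
    (huv : ∀ z ∈ Metric.ball (0 : ℂ) 1, ‖u z‖ ≤ C * ‖v z‖)
    (hb : Summable fun n => ‖b n‖ ^ 2) (N : ℕ) :
    ∑ n ∈ Finset.range N, ‖a n‖ ^ 2 ≤ C ^ 2 * ∑' n, ‖b n‖ ^ 2 := by
  -- On the circle of radius `r` both series converge absolutely, so Parseval turns the pointwise
  -- bound into an `L²` bound.
  have key : ∀ r : ℝ, 0 ≤ r → r < 1 →
      ∑ n ∈ Finset.range N, ‖a n * r ^ n‖ ^ 2 ≤ C ^ 2 * ∑' n, ‖b n‖ ^ 2 := by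
    intro r hr0 hr1
    have hrball : (r : ℂ) ∈ Metric.ball (0 : ℂ) 1 := by
      rw [mem_ball_zero_iff, Complex.norm_real, Real.norm_of_nonneg hr0]
      exact hr1
    have hcircle : ∀ x : UnitAddCircle, ‖(fourier 1 x : ℂ)‖ = 1 := fun x => by
      rw [fourier_apply, Circle.norm_coe]
    have hpow : ∀ (n : ℕ) (x : UnitAddCircle), fourier (n : ℤ) x = (fourier 1 x : ℂ) ^ n := by
      intro n x
      simp only [fourier_apply, one_zsmul, AddCircle.toCircle_zsmul]
      simp
    have hball : ∀ x : UnitAddCircle, (r : ℂ) * fourier 1 x ∈ Metric.ball (0 : ℂ) 1 := fun x => by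
      rw [mem_ball_zero_iff, norm_mul, hcircle, mul_one, Complex.norm_real,
        Real.norm_of_nonneg hr0]
      exact hr1
    have main : ∀ (w : ℂ → ℂ) (c : ℕ → ℂ),
        (∀ z ∈ Metric.ball (0 : ℂ) 1, HasSum (fun n => c n * z ^ n) (w z)) →
        ∃ φ : C(UnitAddCircle, ℂ), (∀ x, φ x = w (r * fourier 1 x)) ∧
          HasSum (fun n => ‖c n * (r : ℂ) ^ n‖ ^ 2)
            (‖ContinuousMap.toLp (E := ℂ) 2 AddCircle.haarAddCircle ℂ φ‖ ^ 2) := by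
      intro w c hw
      have hs : Summable fun n => ‖c n * (r : ℂ) ^ n‖ := (hw _ hrball).summable.norm
      have hs1 : Summable fun n : ℕ =>
          (c n * (r : ℂ) ^ n) • (fourier (n : ℤ) : C(UnitAddCircle, ℂ)) :=
        Summable.of_norm (by simpa only [norm_smul, fourier_norm, mul_one] using hs)
      have hφ : ∀ x, (∑' n : ℕ, (c n * (r : ℂ) ^ n) • (fourier (n : ℤ) : C(UnitAddCircle, ℂ))) x
          = w (r * fourier 1 x) := fun x => by
        refine ((ContinuousMap.evalCLM ℂ x).hasSum hs1.hasSum).unique ?_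
        refine (hw _ (hball x)).congr_fun ?_
        intro n
        change c n * (r : ℂ) ^ n * fourier (n : ℤ) x = _
        rw [hpow, mul_pow, mul_assoc]
      refine ⟨_, hφ, hasSum_sq_of_hasSum_fourier hs _ fun x => ?_⟩
      rw [hφ]
      refine (hw _ (hball x)).congr_fun ?_
      intro n
      rw [hpow, mul_pow, mul_assoc]
    obtain ⟨φ, hφ, hφs⟩ := main u a hu
    obtain ⟨ψ, hψ, hψs⟩ := main v b hv
    have hle : ‖ContinuousMap.toLp (E := ℂ) 2 AddCircle.haarAddCircle ℂ φ‖ ≤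
        C * ‖ContinuousMap.toLp (E := ℂ) 2 AddCircle.haarAddCircle ℂ ψ‖ := by
      refine MeasureTheory.Lp.norm_le_mul_norm_of_ae_le_mul ?_
      filter_upwards [ContinuousMap.coeFn_toLp (E := ℂ) (p := 2) (𝕜 := ℂ)
          (AddCircle.haarAddCircle (T := 1)) φ, ContinuousMap.coeFn_toLp (E := ℂ) (p := 2) (𝕜 := ℂ)
          (AddCircle.haarAddCircle (T := 1)) ψ] with x h1 h2
      rw [h1, h2, hφ, hψ]
      exact huv _ (hball x)
    calc ∑ n ∈ Finset.range N, ‖a n * (r : ℂ) ^ n‖ ^ 2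
        ≤ ‖ContinuousMap.toLp (E := ℂ) 2 AddCircle.haarAddCircle ℂ φ‖ ^ 2 :=
          sum_le_hasSum _ (fun _ _ => by positivity) hφs
      _ ≤ (C * ‖ContinuousMap.toLp (E := ℂ) 2 AddCircle.haarAddCircle ℂ ψ‖) ^ 2 := by gcongr
      _ = C ^ 2 * ∑' n, ‖b n * (r : ℂ) ^ n‖ ^ 2 := by rw [mul_pow, hψs.tsum_eq]
      _ ≤ C ^ 2 * ∑' n, ‖b n‖ ^ 2 := by
        refine mul_le_mul_of_nonneg_left (hψs.summable.tsum_le_tsum (fun n => ?_) hb) (by positivity)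
        rw [norm_mul, norm_pow, Complex.norm_real, Real.norm_of_nonneg hr0]
        gcongr
        exact mul_le_of_le_one_right (norm_nonneg _) (pow_le_one₀ hr0 hr1.le)
  -- A finite partial sum is continuous up to `r = 1`, so the limit needs no summability of `‖a n‖ ^
  -- 2`.
  have hcont : Continuous fun r : ℝ => ∑ n ∈ Finset.range N, ‖a n * (r : ℂ) ^ n‖ ^ 2 := by fun_prop
  have hlim := (hcont.tendsto 1).mono_left (nhdsWithin_le_nhds (s := Set.Iio 1))
  simp only [Complex.ofReal_one, one_pow, mul_one] at hlim
  refine le_of_tendsto hlim ?_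
  filter_upwards [self_mem_nhdsWithin, nhdsWithin_le_nhds (Ici_mem_nhds zero_lt_one)] with r h1 h0
  exact key r h0 h1

/-! ### The Hardy module as a multiplier module -/

namespace HardySpace

/-- The holomorphic function on the disk with the Taylor coefficients of `g`. -/
def toFun (g : HardySpace) (z : ℂ) : ℂ := ∑' n, g.coeff n * z ^ n

theorem hasSum_toFun (g : HardySpace) {z : ℂ} (hz : z ∈ Metric.ball (0 : ℂ) 1) :
    HasSum (fun n => g.coeff n * z ^ n) (g.toFun z) :=
  (hasSum_inner_szego ⟨z, hz⟩ g).summable.hasSum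

theorem toFun_eq_inner (g : HardySpace) (w : Metric.ball (0 : ℂ) 1) :
    g.toFun w = ⟪szego w, g⟫_ℂ := eval_eq_inner g w

theorem differentiableOn_toFun (g : HardySpace) :
    DifferentiableOn ℂ g.toFun (Metric.ball 0 1) := by
  intro z hz
  obtain ⟨r, hr, hr1⟩ := exists_between (mem_ball_zero_iff.1 hz)
  have hr0 : 0 ≤ r := (norm_nonneg z).trans hr.le
  have hrball : (r : ℂ) ∈ Metric.ball (0 : ℂ) 1 := by
    rw [mem_ball_zero_iff, Complex.norm_real, Real.norm_of_nonneg hr0]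
    exact hr1
  have hd : DifferentiableOn ℂ g.toFun (Metric.ball 0 r) := by
    refine Complex.differentiableOn_tsum_of_summable_norm
      (hasSum_toFun g hrball).summable.norm (fun n => by fun_prop) Metric.isOpen_ball ?_
    intro n w hw
    rw [norm_mul, norm_mul, norm_pow, norm_pow, Complex.norm_real, Real.norm_of_nonneg hr0]
    gcongr
    exact (mem_ball_zero_iff.1 hw).le
  exact (hd.differentiableAt (Metric.isOpen_ball.mem_nhds
    (mem_ball_zero_iff.2 hr))).differentiableWithinAt

theorem exists_mul {f : ℂ → ℂ} (hf : DifferentiableOn ℂ f (Metric.ball 0 1)) {C : ℝ}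
    (hC : ∀ z ∈ Metric.ball (0 : ℂ) 1, ‖f z‖ ≤ C) (g : HardySpace) :
    ∃ u : HardySpace, ‖u‖ ≤ C * ‖g‖ ∧
      ∀ w : Metric.ball (0 : ℂ) 1, ⟪szego w, u⟫_ℂ = f w * ⟪szego w, g⟫_ℂ := by
  have hC0 : 0 ≤ C := (norm_nonneg _).trans (hC 0 (by simp))
  have hd : DifferentiableOn ℂ (fun z => f z * g.toFun z) (Metric.ball 0 1) :=
    hf.mul g.differentiableOn_toFun
  obtain ⟨c, hc⟩ : ∃ c : ℕ → ℂ, ∀ z ∈ Metric.ball (0 : ℂ) 1,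
      HasSum (fun n => c n * z ^ n) (f z * g.toFun z) := by
    refine ⟨fun n => (n.factorial : ℂ)⁻¹ * iteratedDeriv n (fun z => f z * g.toFun z) 0,
      fun z hz => ?_⟩
    refine (Complex.hasSum_taylorSeries_on_ball hd hz).congr_fun fun n => ?_
    simp only [sub_zero, smul_eq_mul]
    ring
  have hbound := sum_sq_le_of_norm_le hc (fun z hz => hasSum_toFun g hz) (C := C)
    (fun z hz => by
      rw [norm_mul]
      exact mul_le_mul_of_nonneg_right (hC z hz) (norm_nonneg _)) g.summable_sq
  have hsum : Summable fun n => ‖c n‖ ^ 2 :=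
    summable_of_sum_range_le (fun n => by positivity) hbound
  refine ⟨ofCoeff c hsum, ?_, fun w => ?_⟩
  · refine (sq_le_sq₀ (norm_nonneg _) (by positivity)).1 ?_
    rw [mul_pow, norm_sq_eq, norm_sq_eq]
    exact Real.tsum_le_of_sum_range_le (fun n => by positivity) hbound
  · rw [← toFun_eq_inner g]
    exact (hasSum_inner_szego w (ofCoeff c hsum)).unique (hc w w.2)

theorem ext_szego {f g : HardySpace}
    (h : ∀ w : Metric.ball (0 : ℂ) 1, ⟪szego w, f⟫_ℂ = ⟪szego w, g⟫_ℂ) : f = g :=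
  eval_injective (funext fun w => by rw [eval_eq_inner, eval_eq_inner, h])

theorem exists_multiplier {f : ℂ → ℂ} (hf : IsHInfty f) : ∃ A : HardySpace →L[ℂ] HardySpace,
    ∀ (w : Metric.ball (0 : ℂ) 1) (g : HardySpace),
      ⟪szego w, A g⟫_ℂ = f w * ⟪szego w, g⟫_ℂ := by
  obtain ⟨C, hC⟩ := hf.bounded
  choose A hAn hA using exists_mul hf.differentiableOn hC
  refine ⟨LinearMap.mkContinuous
    { toFun := A
      map_add' := fun g h => ext_szego fun w => by
        rw [inner_add_right, hA, hA, hA, inner_add_right, mul_add]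
      map_smul' := fun c g => ext_szego fun w => by
        rw [RingHom.id_apply, inner_smul_right, hA, hA, inner_smul_right, mul_left_comm] } C hAn,
    fun w g => hA g w⟩

theorem szego_mem_eigenFibre (w : Metric.ball (0 : ℂ) 1) : szego w ∈ eigenFibre mulZ (w : ℂ) :=
  mem_eigenFibre_iff.2 fun f => by
    rw [← eval_eq_inner, ← eval_eq_inner]
    exact mulZ_apply f w

theorem szego_ne_zero (w : Metric.ball (0 : ℂ) 1) : szego w ≠ 0 := fun h => by
  have h0 : (szego w).coeff 0 = 1 := pow_zero _
  rw [h] at h0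
  exact zero_ne_one h0

theorem inner_eq_tsum (f g : HardySpace) :
    ⟪f, g⟫_ℂ = ∑' n, g.coeff n * starRingEnd ℂ (f.coeff n) :=
  (lp.hasSum_inner (𝕜 := ℂ) (show lp (fun _ : ℕ => ℂ) 2 from f)
    (show lp (fun _ : ℕ => ℂ) 2 from g)).tsum_eq.symm

/-- Pairing `k` with the monomials, which the shift moves up by one degree, makes its coefficients
geometric with ratio `conj w`. -/
theorem exists_eq_smul_szego {w : Metric.ball (0 : ℂ) 1} {k : HardySpace}
    (hk : k ∈ eigenFibre mulZ (w : ℂ)) : ∃ c : ℂ, c • szego w = k := by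
  have hsum : ∀ n : ℕ, Summable fun m => ‖(Pi.single n 1 : ℕ → ℂ) m‖ ^ 2 := fun n =>
    summable_of_ne_finset_zero (s := {n}) fun m hm => by
      simp [Finset.mem_singleton.not.1 hm]
  let e : ℕ → HardySpace := fun n => ofCoeff (Pi.single n 1) (hsum n)
  have he : ∀ n m, (e n).coeff m = if m = n then 1 else 0 := fun n m => Pi.single_apply n 1 m
  have hshift : ∀ n, mulZ (e n) = e (n + 1) := fun n => ext_coeff fun m => by
    cases m with
    | zero =>
      rw [he, if_neg (by lia)]
      rfl
    | succ m =>
      have : (mulZ (e n)).coeff (m + 1) = (e n).coeff m := rfl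
      rw [this, he, he]
      simp
  have hinner : ∀ n, ⟪k, e n⟫_ℂ = starRingEnd ℂ (k.coeff n) := fun n => by
    rw [inner_eq_tsum, tsum_eq_single n fun m hm => by rw [he, if_neg hm, zero_mul], he, if_pos rfl,
      one_mul]
  have hrec : ∀ n, k.coeff (n + 1) = starRingEnd ℂ (w : ℂ) * k.coeff n := fun n => by
    have h1 := mem_eigenFibre_iff.1 hk (e n)
    rw [hshift, hinner, hinner] at h1
    have h2 := congrArg (starRingEnd ℂ) h1
    simpa only [map_mul, Complex.conj_conj] using h2
  refine ⟨k.coeff 0, ext_coeff fun n => ?_⟩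
  change k.coeff 0 * starRingEnd ℂ (w : ℂ) ^ n = k.coeff n
  induction n with
  | zero => simp
  | succ n ih => rw [hrec, ← ih]; ring

theorem isMultiplierModule_mulZ : IsMultiplierModule mulZ where
  finrank_fibre w hw := by
    refine finrank_eq_one (⟨szego ⟨w, hw⟩, szego_mem_eigenFibre ⟨w, hw⟩⟩ : eigenFibre mulZ w)
      (fun h => szego_ne_zero _ (congrArg Subtype.val h)) fun k => ?_
    obtain ⟨c, hc⟩ := exists_eq_smul_szego (w := ⟨w, hw⟩) k.2
    exact ⟨c, Subtype.ext hc⟩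
  ext_fibres h hh := ext_szego fun w => by
    rw [hh w w.2 _ (szego_mem_eigenFibre w), inner_zero_right]
  exists_section w₀ hw₀ := by
    classical
    have hk : ∀ w (hw : w ∈ Metric.ball (0 : ℂ) 1),
        (if hw : w ∈ Metric.ball (0 : ℂ) 1 then szego ⟨w, hw⟩ else 0) = szego ⟨w, hw⟩ :=
      fun w hw => dif_pos hw
    have hnhds := Metric.isOpen_ball.mem_nhds hw₀
    -- The Szegő kernel is a global section, extended by zero off the disk; its pairing with `h` is
    -- the function of `h` itself.
    refine ⟨fun w => if hw : w ∈ Metric.ball (0 : ℂ) 1 then szego ⟨w, hw⟩ else 0, ?_, ?_,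
      fun h => ?_⟩
    · simp only [hk w₀ hw₀]
      exact szego_ne_zero _
    · filter_upwards [hnhds] with w hw
      rw [hk w hw]
      exact szego_mem_eigenFibre ⟨w, hw⟩
    · refine (h.differentiableOn_toFun.differentiableAt hnhds).congr_of_eventuallyEq ?_
      filter_upwards [hnhds] with w hw
      rw [hk w hw]
      exact (toFun_eq_inner h ⟨w, hw⟩).symm
  exists_multiplier f hf := by
    obtain ⟨A, hA⟩ := exists_multiplier hf
    refine ⟨A, fun w hw k hk h => ?_⟩
    obtain ⟨c, rfl⟩ := exists_eq_smul_szego (w := ⟨w, hw⟩) hk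
    rw [inner_smul_left, inner_smul_left, hA, mul_left_comm]

end HardySpace

end

theorem theorem4p4 {H : Type*} [NormedAddCommGroup H] [InnerProductSpace ℂ H] [CompleteSpace H]
    (ρ : DiskAlgebra →A[ℂ] (H →L[ℂ] H))
    (hH : IsCowenDouglasDual 1 (Metric.ball (0 : ℂ) 1) (ρ DiskAlgebra.coord))
    (p q : ℕ)
    (Θ : ℂ → EuclideanSpace ℂ (Fin p) →L[ℂ] EuclideanSpace ℂ (Fin q)) (hΘ : IsHInfty Θ)
    (hΨ : ∃ Ψ : ℂ → EuclideanSpace ℂ (Fin q) →L[ℂ] EuclideanSpace ℂ (Fin p), IsHInfty Ψ ∧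
      ∀ z ∈ Metric.ball (0 : ℂ) 1, Ψ z ∘L Θ z = ContinuousLinearMap.id ℂ _)
    (F : Type*) [NormedAddCommGroup F] [InnerProductSpace ℂ F] [FiniteDimensional ℂ F] :
    IsMultiplier (ρ DiskAlgebra.coord) Θ ∧ IsMultiplier HardySpace.mulZ Θ ∧
    (AreSimilar (quotientShift (ρ DiskAlgebra.coord) Θ) ((ρ DiskAlgebra.coord).rTensor F) ↔
      AreSimilar (quotientShift HardySpace.mulZ Θ) (HardySpace.mulZ.rTensor F)) := by
  have hT := isMultiplierModule_of_diskAlgebra ρ hH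
  have hZ := HardySpace.isMultiplierModule_mulZ
  obtain ⟨Ψ, hΨ, hΨΘ⟩ := hΨ
  exact ⟨hT.isMultiplier hΘ, hZ.isMultiplier hΘ,
    (hT.areSimilar_quotientShift_iff hΘ hΨ hΨΘ).trans
      (hZ.areSimilar_quotientShift_iff hΘ hΨ hΨΘ).symm⟩
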